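/- **Theorem (Separation).** Let $\mathbb{U}$ be a standard universe, that is, a well-founded universe of sets (possibly with atoms) that satisfies extensionality for sets, contains the empty set, and is closed under unordered pairs, unions, power sets and arbitrary subsets (for example a superstructure over a set of atoms). Regard $\mathbb{U}$ as a first-order structure for the language of set theory with atoms (membership and "is a set"). Let ${}^{*}\mathbb{U}$ be a sufficiently saturated elementary extension of $\mathbb{U}$: it is $\kappa$-saturated for some cardinal $\kappa$ that is greater than the cardinality of every standard set $S \in \mathbb{U}$ (for instance $\kappa = |\mathbb{U}|^{+}$). A subset of ${}^{*}\mathbb{U}$ is *internal* if it is of the form $\{x \in {}^{*}\mathbb{U} : x \mathrel{{}^{*}{\in}} a\}$ for some set $a$ of ${}^{*}\mathbb{U}$. A subset $G$ of ${}^{*}\mathbb{U}$ is *galactic* if there are a standard set $S \in \mathbb{U}$ and a (not necessarily internal) family $(G_i)_{i \in S}$ of internal sets such that $G = \bigcup_{i \in S} G_i$. A subset $H$ of ${}^{*}\mathbb{U}$ is *halic* if there are a standard set $S \in \mathbb{U}$ and a (not necessarily internal) family $(H_i)_{i \in S}$ of internal sets such that $H = \bigcap_{i \in S} H_i$, where the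 intersection is taken in ${}^{*}\mathbb{U}$. Let $G$ be a galactic set and $H$ a halic set with $G \subseteq H$. Then there exists an internal set $I$ such that $G \subseteq I \subseteq H$. -/

import Mathlib

universe u v

namespace Nonstandard

/-- The relation symbols of the language of set theory with atoms (urelements): a unary symbol
for being a set and a binary symbol for membership. -/
inductive SetRel : ℕ → Type
  | isSet : SetRel 1
  | mem : SetRel 2

/-- The first-order language of set theory with atoms. -/
def setLang : FirstOrder.Language.{0, 0} where
  Functions := fun _ => Empty
  Relations := SetRel

/-- `x` is a set (as opposed to an atom) in the sense of the structure `M`. -/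
def IsSet {M : Type*} [setLang.Structure M] (x : M) : Prop :=
  FirstOrder.Language.Structure.RelMap (L := setLang) SetRel.isSet ![x]

/-- `x` is a member of `y` in the sense of the structure `M`. -/
def Mem {M : Type*} [setLang.Structure M] (x y : M) : Prop :=
  FirstOrder.Language.Structure.RelMap (L := setLang) SetRel.mem ![x, y]

/-- A standard universe: a well-founded universe of sets and atoms that is closed under pairs,
unions, power sets, and arbitrary subsets. For example, the superstructure over a set of atoms, a
stage `V_α` of the cumulative hierarchy with `α > 0` a limit ordinal, or a Grothendieck universe.
In the field `subset`, `A` ranges over all subsets of the universe, not just the definable ones. -/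
structure IsStandardUniverse (U : Type*) [setLang.Structure U] : Prop where
  wf : WellFounded (fun x y : U => Mem x y)
  isSet_of_mem : ∀ x y : U, Mem x y → IsSet y
  ext : ∀ x y : U, IsSet x → IsSet y → (∀ z, Mem z x ↔ Mem z y) → x = y
  empty : ∃ e : U, IsSet e ∧ ∀ x, ¬ Mem x e
  pair : ∀ x y : U, ∃ p : U, ∀ z, Mem z p ↔ z = x ∨ z = y
  union : ∀ x : U, ∃ u : U, IsSet u ∧ ∀ z, Mem z u ↔ ∃ y, Mem y x ∧ Mem z y
  power : ∀ x : U, ∃ p : U, ∀ y, Mem y p ↔ IsSet y ∧ ∀ z, Mem z y → Mem z x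
  subset : ∀ (x : U) (A : Set U), ∃ y : U, IsSet y ∧ ∀ z, Mem z y ↔ Mem z x ∧ z ∈ A

/-- `M` is `κ`-saturated: every family of subsets of `M` that are first-order definable with
parameters from a fixed set of fewer than `κ` parameters, and that has the finite intersection
property, has nonempty intersection. (Equivalently, every partial type in one variable over fewer
than `κ` parameters that is finitely satisfiable in `M` is realized in `M`.) -/
def IsSaturated (L : FirstOrder.Language.{0, 0}) (M : Type*) [L.Structure M] 
    (κ : Cardinal) : Prop :=
  ∀ P : Set M, Cardinal.mk P < κ →
    ∀ 𝓕 : Set (Set M), (∀ D ∈ 𝓕, P.Definable₁ L D) →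
      (∀ 𝓣 : Set (Set M), 𝓣 ⊆ 𝓕 → 𝓣.Finite → (⋂₀ 𝓣).Nonempty) →
        (⋂₀ 𝓕).Nonempty

/-- A subset of the nonstandard universe `M` is internal if it consists of the members, in the sense
of `M`, of some set of `M`. -/
def IsInternal {M : Type*} [setLang.Structure M] (A : Set M) : Prop :=
  ∃ a : M, IsSet a ∧ A = {x | Mem x a}

/-- A subset `G` of `M` is galactic (over the standard universe `U`) if it is the union of a family
of internal sets indexed by the members of a standard set `S`. The family need not be internal. -/
def IsGalactic (U : Type*) [setLang.Structure U] {M : Type*} [setLang.Structure M]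
    (G : Set M) : Prop :=
  ∃ S : U, IsSet S ∧ ∃ F : {i : U // Mem i S} → Set M, (∀ i, IsInternal (F i)) ∧ G = ⋃ i, F i

/-- A subset `H` of `M` is halic (over the standard universe `U`) if it is the intersection, in `M`,
of a family of internal sets indexed by the members of a standard set `S`. The family need not be
internal. -/
def IsHalic (U : Type*) [setLang.Structure U] {M : Type*} [setLang.Structure M]
    (H : Set M) : Prop :=
  ∃ S : U, IsSet S ∧ ∃ F : {i : U // Mem i S} → Set M, (∀ i, IsInternal (F i)) ∧ H = ⋂ i, F i

end Nonstandard

namespace Nonstandard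

open FirstOrder FirstOrder.Language

/-! Let `g i` and `h j` be the sets of `M` whose members make up the pieces of `G` and `H`. An
internal separator is a set `a` that includes every `g i` and is included in every `h j`. Each of
these conditions is definable from one parameter, and there are fewer than `κ` parameters in all,
since `κ` is infinite and exceeds the size of both index sets. Finitely many conditions are met by
the union of the finitely many `g i` involved, because `G ⊆ H`; this union exists as `M` inherits
the empty set and binary unions from `U` by transfer. Saturation then yields `a`
(`exists_internal_between`). -/

/-- The atomic formula saying that the term `t` is a set. -/
def isSetFormula {α : Type*} {n : ℕ} (t : setLang.Term (α ⊕ Fin n)) :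
    setLang.BoundedFormula α n :=
  Relations.boundedFormula₁ (L := setLang) (SetRel.isSet : setLang.Relations 1) t

/-- The atomic formula saying that the term `s` is a member of the term `t`. -/
def memFormula {α : Type*} {n : ℕ} (s t : setLang.Term (α ⊕ Fin n)) :
    setLang.BoundedFormula α n :=
  Relations.boundedFormula₂ (L := setLang) (SetRel.mem : setLang.Relations 2) s t

section Realize

variable {M : Type*} [setLang.Structure M]

@[simp]
theorem realize_isSetFormula {α : Type*} {n : ℕ} (t : setLang.Term (α ⊕ Fin n)) (v : α → M)
    (w : Fin n → M) : (isSetFormula t).Realize v w ↔ IsSet (t.realize (Sum.elim v w)) :=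
  BoundedFormula.realize_rel₁

@[simp]
theorem realize_memFormula {α : Type*} {n : ℕ} (s t : setLang.Term (α ⊕ Fin n)) (v : α → M)
    (w : Fin n → M) : (memFormula s t).Realize v w ↔
      Mem (s.realize (Sum.elim v w)) (t.realize (Sum.elim v w)) :=
  BoundedFormula.realize_rel₂

/-- The sentence saying that there is an empty set. -/
def emptySentence : setLang.Sentence :=
  ∃' (isSetFormula (&0) ⊓ ∀' ∼(memFormula (&1) (&0)))

theorem realize_emptySentence :
    M ⊨ emptySentence ↔ ∃ e : M, IsSet e ∧ ∀ x, ¬ Mem x e := by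
  simp [emptySentence, Sentence.Realize, Formula.Realize, Fin.snoc]

/-- The sentence saying that any two objects have a binary union. -/
def unionSentence : setLang.Sentence :=
  ∀' ∀' ∃' (isSetFormula (&2) ⊓
    ∀' ((memFormula (&3) (&2)).iff (memFormula (&3) (&0) ⊔ memFormula (&3) (&1))))

theorem realize_unionSentence :
    M ⊨ unionSentence ↔
      ∀ x y : M, ∃ u, IsSet u ∧ ∀ z, Mem z u ↔ Mem z x ∨ Mem z y := by
  simp [unionSentence, Sentence.Realize, Formula.Realize, Fin.snoc]

/-- A set cut out by a formula with a single parameter from `P` is definable over `P`. -/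
theorem definable₁_of_formula {L : FirstOrder.Language.{0, 0}} {M : Type*} [L.Structure M] {P : Set M}
    (φ : L.Formula (Fin 2)) {g : M} (hg : g ∈ P) :
    P.Definable₁ L {a | φ.Realize ![a, g]} := by
  -- Variable 0 stays free; variable 1 is replaced by the parameter `g`.
  refine Set.definable_iff_exists_formula_sum.2
    ⟨φ.relabel ![Sum.inr 0, Sum.inl ⟨g, hg⟩], ?_⟩
  ext v
  simp only [Set.mem_ofPred_eq, Formula.realize_relabel]
  refine iff_of_eq (congrArg _ ?_)
  ext i
  fin_cases i <;> rfl

theorem definable₁_isSet (P : Set M) : P.Definable₁ setLang {a : M | IsSet a} := by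
  refine Set.definable_iff_exists_formula_sum.2
    ⟨isSetFormula (Term.var (Sum.inl (Sum.inr 0))), ?_⟩
  ext v
  simp [Formula.Realize]

theorem definable₁_superset {P : Set M} {g : M} (hg : g ∈ P) :
    P.Definable₁ setLang {a : M | ∀ z, Mem z g → Mem z a} := by
  convert definable₁_of_formula (L := setLang) (∀' ((memFormula (&0) (Term.var (Sum.inl 1))).imp
    (memFormula (&0) (Term.var (Sum.inl 0))))) hg using 2
  simp [Formula.Realize, Fin.snoc]

theorem definable₁_subset {P : Set M} {h : M} (hh : h ∈ P) :
    P.Definable₁ setLang {a : M | ∀ z, Mem z a → Mem z h} := by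
  convert definable₁_of_formula (L := setLang) (∀' ((memFormula (&0) (Term.var (Sum.inl 0))).imp
    (memFormula (&0) (Term.var (Sum.inl 1))))) hh using 2
  simp [Formula.Realize, Fin.snoc]

end Realize

namespace IsStandardUniverse

variable {U : Type u} [setLang.Structure U] (hU : IsStandardUniverse U)
include hU

theorem exists_binary_union (x y : U) :
    ∃ w, IsSet w ∧ ∀ z, Mem z w ↔ Mem z x ∨ Mem z y := by
  obtain ⟨p, hp⟩ := hU.pair x y
  obtain ⟨w, hw, hwp⟩ := hU.union p
  exact ⟨w, hw, fun z => by simp [hwp, hp]⟩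

/-- Cantor's theorem in a standard universe: every set is smaller than some other set. -/
theorem exists_mk_members_lt (S : U) :
    ∃ T : U, Cardinal.mk {i : U // Mem i S} < Cardinal.mk {i : U // Mem i T} := by
  obtain ⟨T, hT⟩ := hU.power S
  -- Closure under arbitrary subsets makes the power set full: each external `A ⊆ S` is represented
  -- by a set of `U`, so `T` has at least `2 ^ |S|` members.
  choose f hf hfS using hU.subset S
  refine ⟨T, (Cardinal.cantor _).trans_le ?_⟩
  rw [← Cardinal.mk_set]
  refine Cardinal.mk_le_of_injective
    (f := fun A : Set {i : U // Mem i S} => (⟨f (Subtype.val '' A),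
      (hT _).2 ⟨hf _, fun z hz => ((hfS _ z).1 hz).1⟩⟩ : {i : U // Mem i T})) ?_
  intro A B hAB
  have hAB : f (Subtype.val '' A) = f (Subtype.val '' B) := congrArg Subtype.val hAB
  ext ⟨i, hi⟩
  have hA := hfS (Subtype.val '' A) i
  have hB := hfS (Subtype.val '' B) i
  rw [hAB] at hA
  simpa [hi] using hA.symm.trans hB

/-- Cantor's theorem is iterated `n` times; this is what forces `κ` to be infinite. -/
theorem exists_natCast_le_mk_members (n : ℕ) :
    ∃ S : U, (n : Cardinal) ≤ Cardinal.mk {i : U // Mem i S} := by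
  induction n with
  | zero =>
    obtain ⟨e, -⟩ := hU.empty
    exact ⟨e, by simp⟩
  | succ n ih =>
    obtain ⟨S, hS⟩ := ih
    obtain ⟨T, hT⟩ := hU.exists_mk_members_lt S
    refine ⟨T, ?_⟩
    rw [Nat.cast_succ, ← Cardinal.succ_natCast]
    exact Order.succ_le_of_lt (hS.trans_lt hT)

/-- A cardinal that exceeds the cardinality of every standard set is infinite. -/
theorem aleph0_le {κ : Cardinal.{v}}
    (hκ : ∀ S : U, Cardinal.lift.{v} (Cardinal.mk {i : U // Mem i S}) < Cardinal.lift.{u} κ) :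
    Cardinal.aleph0 ≤ κ := by
  refine Cardinal.aleph0_le.2 fun n => ?_
  obtain ⟨S, hS⟩ := hU.exists_natCast_le_mk_members n
  have h := (Cardinal.lift_le.{v}.2 hS).trans (hκ S).le
  rw [Cardinal.lift_natCast] at h
  simpa using h

end IsStandardUniverse

/-- Separation of a union of fewer than `κ` internal sets from an intersection of fewer than `κ`
internal sets in a `κ`-saturated structure that has an empty set and binary unions. -/
theorem exists_internal_between {M : Type v} [setLang.Structure M] {κ : Cardinal.{v}}
    (hM : IsSaturated setLang M κ) (empty : ∃ e : M, IsSet e ∧ ∀ x, ¬ Mem x e)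
    (union : ∀ x y : M, ∃ w, IsSet w ∧ ∀ z, Mem z w ↔ Mem z x ∨ Mem z y)
    {ι ι' : Type*} (g : ι → M) (h : ι' → M)
    (hcard : Cardinal.mk ↥(Set.range g ∪ Set.range h) < κ)
    (hgh : ∀ i j z, Mem z (g i) → Mem z (h j)) :
    ∃ a : M, IsSet a ∧ (∀ i z, Mem z (g i) → Mem z a) ∧ ∀ j z, Mem z a → Mem z (h j) := by
  obtain ⟨e, he, hxe⟩ := empty
  let 𝓕 : Set (Set M) := insert {a | IsSet a}
    (Set.range (fun i => {a | ∀ z, Mem z (g i) → Mem z a}) ∪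
      Set.range fun j => {a | ∀ z, Mem z a → Mem z (h j)})
  have hdef : ∀ D ∈ 𝓕, (Set.range g ∪ Set.range h).Definable₁ setLang D := by
    rintro D (rfl | ⟨i, rfl⟩ | ⟨j, rfl⟩)
    · exact definable₁_isSet _
    · exact definable₁_superset (Or.inl ⟨i, rfl⟩)
    · exact definable₁_subset (Or.inr ⟨j, rfl⟩)
  -- Each member of `𝓕` contains all sets between a certain lower bound and all the `h j`.
  have hlower : ∀ D ∈ 𝓕, ∃ b : M, (∀ j z, Mem z b → Mem z (h j)) ∧
      ∀ a, IsSet a → (∀ z, Mem z b → Mem z a) → (∀ j z, Mem z a → Mem z (h j)) → a ∈ D := by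
    rintro D (rfl | ⟨i, rfl⟩ | ⟨j, rfl⟩)
    -- Only the conditions `g i ⊆ a` demand anything from below; for the others the empty set is a
    -- sufficient lower bound.
    · exact ⟨e, fun _ z hz => (hxe z hz).elim, fun a ha _ _ => ha⟩
    · exact ⟨g i, hgh i, fun a _ hba _ => hba⟩
    · exact ⟨e, fun _ z hz => (hxe z hz).elim, fun a _ _ hah => hah j⟩
  have hfip : ∀ 𝓣 : Set (Set M), 𝓣 ⊆ 𝓕 → 𝓣.Finite → (⋂₀ 𝓣).Nonempty := by
    intro 𝓣 h𝓣 hfin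
    -- Nonemptiness alone would not survive the induction: the witness must stay valid when enlarged
    -- below all `h j`, so that unions can be taken.
    suffices ∃ b : M, IsSet b ∧ (∀ j z, Mem z b → Mem z (h j)) ∧ ∀ a, IsSet a →
        (∀ z, Mem z b → Mem z a) → (∀ j z, Mem z a → Mem z (h j)) → a ∈ ⋂₀ 𝓣 by
      obtain ⟨b, hb, hbh, hbT⟩ := this
      exact ⟨b, hbT b hb (fun _ hz => hz) hbh⟩
    induction 𝓣, hfin using Set.Finite.induction_on with
    | empty => exact ⟨e, he, fun _ z hz => (hxe z hz).elim, by simp⟩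
    | @insert D 𝓣 _ _ ih =>
      obtain ⟨b, -, hbh, hbT⟩ := ih ((Set.subset_insert _ _).trans h𝓣)
      obtain ⟨c, hch, hcD⟩ := hlower D (h𝓣 (Set.mem_insert _ _))
      obtain ⟨w, hw, hwbc⟩ := union b c
      refine ⟨w, hw, fun j z hz => ((hwbc z).1 hz).elim (hbh j z) (hch j z),
        fun a ha hwa hah => ?_⟩
      rw [Set.sInter_insert]
      exact ⟨hcD a ha (fun z hz => hwa z ((hwbc z).2 (Or.inr hz))) hah,
        hbT a ha (fun z hz => hwa z ((hwbc z).2 (Or.inl hz))) hah⟩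
  obtain ⟨a, ha⟩ := hM _ hcard 𝓕 hdef hfip
  exact ⟨a, ha _ (Or.inl rfl), fun i => ha _ (Or.inr (Or.inl ⟨i, rfl⟩)),
    fun j => ha _ (Or.inr (Or.inr ⟨j, rfl⟩))⟩

end Nonstandard

open Nonstandard in
theorem mainTheorem2
    (U : Type u) [Nonstandard.setLang.Structure U] (hU : Nonstandard.IsStandardUniverse U)
    (M : Type v) [Nonstandard.setLang.Structure M]
    (star : FirstOrder.Language.ElementaryEmbedding Nonstandard.setLang U M)
    (κ : Cardinal.{v})
    (hκ : ∀ S : U, Cardinal.lift.{v} (Cardinal.mk {i : U // Nonstandard.Mem i S})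
      < Cardinal.lift.{u} κ)
    (hM : Nonstandard.IsSaturated Nonstandard.setLang M κ)
    (G H : Set M) (hG : Nonstandard.IsGalactic U G) (hH : Nonstandard.IsHalic U H)
    (hGH : G ⊆ H) :
    ∃ I : Set M, Nonstandard.IsInternal I ∧ G ⊆ I ∧ I ⊆ H := by
  obtain ⟨S, -, F, hF, rfl⟩ := hG
  obtain ⟨T, -, K, hK, rfl⟩ := hH
  choose g _ hFg using hF
  choose h _ hKh using hK
  have hcard : Cardinal.mk ↥(Set.range g ∪ Set.range h) < κ := by
    -- A sum of two cardinals below `κ` is below `κ` because `κ` is infinite.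
    refine (Cardinal.mk_union_le _ _).trans_lt
      (Cardinal.add_lt_of_lt (hU.aleph0_le hκ) ?_ ?_) <;> rw [← Cardinal.lift_lt.{v, u}]
    · exact Cardinal.mk_range_le_lift.trans_lt (hκ S)
    · exact Cardinal.mk_range_le_lift.trans_lt (hκ T)
  have hgh : ∀ i j z, Mem z (g i) → Mem z (h j) := by
    intro i j z hz
    have hzF : z ∈ F i := by rw [hFg]; exact hz
    have hzK := Set.mem_iInter.1 (hGH (Set.mem_iUnion.2 ⟨i, hzF⟩)) j
    rw [hKh] at hzK
    exact hzK
  obtain ⟨a, ha, hga, hah⟩ := exists_internal_between hM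
    (realize_emptySentence.1 ((star.map_sentence _).1 (realize_emptySentence.2 hU.empty)))
    (realize_unionSentence.1
      ((star.map_sentence _).1 (realize_unionSentence.2 hU.exists_binary_union)))
    g h hcard hgh
  refine ⟨{x | Mem x a}, ⟨a, ha, rfl⟩, Set.iUnion_subset fun i z hz => ?_,
    Set.subset_iInter fun j z hz => ?_⟩
  · rw [hFg] at hz
    exact hga i z hz
  · rw [hKh]
    exact hah j z hz
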